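/- All graphs are finite and simple. The odd girth of a graph is the length of its shortest odd cycle, and a graph is $F$-free if it has no induced subgraph isomorphic to $F$. For every nonbipartite graph $F$ there is a constant $c'_F$ such that for every positive integer $n$ there is a graph $G$ with $\chi(G) \ge n$ and with the same odd girth as $F$, such that every $F$-free induced subgraph of $G$ is $c'_F$-colourable. -/

import Mathlib

/-- The odd girth of a graph: the length of a shortest odd cycle, and `⊤` if there is none. -/
noncomputable def SimpleGraph.oddGirth {V : Type*} (G : SimpleGraph V) : ℕ∞ :=
  ⨅ (a : V) (w : G.Walk a a) (_ : w.IsCycle ∧ Odd w.length), (w.length : ℕ∞)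

/-! Give the vertices of `F` residues `x v` modulo a prime with no short linear relations, and join
two points of a labelled relation when an arrow between them has label `x b - x a` for an edge `ab`
of `F`. Tutte's construction supplies a transitive relation, labels adding along composition, in
which any few labels are differences of a potential, while every `n`-colouring is constant on some
arrow of a prescribed label (`exists_integrable_relation`).

A short odd cycle of the resulting graph would give a short odd list of darts of `F` with label sum
zero, which genericity forbids (`SimpleGraph.sum_darts_ne_zero`). If, inside an induced subgraph,
arrows of one label `t ≠ 0` form a long chain, transitivity produces multiples of `t` in order, and
`F` embeds as an induced subgraph (`isIndContained_of_chain`). Otherwise each label class is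
coloured by heights, and the product colouring has size depending only on `F`. The whole graph needs
more colours than that, so it contains `F` and the odd girths agree. -/

/-! ### Sparse hypergraphs of large chromatic number, by partite amalgamation. -/

/-- A finite hypergraph, given by its edges `σ e : K → B`, whose vertices cannot be coloured with
`n + 1` colours without a monochromatic edge, and in which fewer than `g` edges form a forest:
prescribed functions on each of them are, up to constants, the restrictions of one function. -/
def HasSparseHypergraph (Γ : Type) [AddCommGroup Γ] (K : Type) (n g : ℕ) : Prop :=
  ∃ (B E : Type) (_ : Finite B) (_ : Finite E) (σ : E → K → B),
    (∀ col : B → Fin (n + 1), ∃ e c, ∀ x, col (σ e x) = c) ∧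
    ∀ T : Finset E, T.card < g → ∀ f : E → K → Γ, ∃ (φ : B → Γ) (c : E → Γ),
      ∀ e ∈ T, ∀ x, φ (σ e x) = f e x + c e

/-- A finite partite hypergraph with parts indexed by `I`, sparse in the same sense, in which every
colouring admits a choice of edges over all transversals `τ : K ↪ I` such that the chosen edges are
coloured consistently in each part belonging to `J`. -/
def HasPartiteHypergraph (Γ : Type) [AddCommGroup Γ] (K I : Type) (J : Finset I) (n g : ℕ) : Prop :=
  ∃ (V E : Type) (_ : Finite V) (_ : Finite E) (σ : E → K → V) (part : V → I),
    (∀ e, Function.Injective fun x => part (σ e x)) ∧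
    (∀ col : V → Fin (n + 1), ∃ ρ : I → Fin (n + 1), ∀ τ : K ↪ I, ∃ e,
      (∀ x, part (σ e x) = τ x) ∧ ∀ x, τ x ∈ J → col (σ e x) = ρ (τ x)) ∧
    ∀ T : Finset E, T.card < g → ∀ f : E → K → Γ, ∃ (φ : V → Γ) (c : E → Γ),
      ∀ e ∈ T, ∀ x, φ (σ e x) = f e x + c e

theorem hasPartiteHypergraph_empty (Γ : Type) [AddCommGroup Γ] (K I : Type) [Finite K] [Finite I]
    (n g : ℕ) : HasPartiteHypergraph Γ K I ∅ n g := by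
  refine ⟨(K ↪ I) × K, K ↪ I, inferInstance, inferInstance, fun τ x => (τ, x),
    fun v => v.1 v.2, fun e => e.injective, fun _ => ⟨fun _ => 0, fun τ => ⟨τ, by simp⟩⟩, ?_⟩
  intro T _ f
  exact ⟨fun v => f v.1 v.2, fun _ => 0, by simp⟩

/-- Amalgamation of copies of a partite hypergraph along one part doubles the sparseness. -/
theorem HasPartiteHypergraph.insert {Γ : Type} [AddCommGroup Γ] {K I : Type} [DecidableEq I]
    {J : Finset I} {n g : ℕ} (i : I)
    (hH : ∀ (L : Type) [Finite L], HasSparseHypergraph Γ L n g)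
    (hP : HasPartiteHypergraph Γ K I J n (2 * g)) :
    HasPartiteHypergraph Γ K I (insert i J) n (2 * g) := by
  classical
  obtain ⟨V, E, _, _, σ, part, hinj, hcol, hint⟩ := hP
  obtain ⟨B, E', _, _, σ', hcol', hint'⟩ := hH {v : V // part v = i}
  -- Copies share only vertices of part `i`, glued along the edges of the auxiliary hypergraph; all
  -- other vertices are private.
  let emb : E' → V → B ⊕ E' × V := fun e v =>
    if h : part v = i then Sum.inl (σ' e ⟨v, h⟩) else Sum.inr (e, v)
  let part' : B ⊕ E' × V → I := Sum.elim (fun _ => i) (fun v => part v.2)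
  have hpart : ∀ e v, part' (emb e v) = part v := by
    intro e v
    by_cases h : part v = i <;> simp [emb, part', h]
  refine ⟨B ⊕ E' × V, E' × E, inferInstance, inferInstance,
    fun e x => emb e.1 (σ e.2 x), part', ?_, ?_, ?_⟩
  · intro e
    simpa only [hpart] using hinj e.2
  · intro col
    obtain ⟨e, c, he⟩ := hcol' fun b => col (Sum.inl b)
    obtain ⟨ρ, hρ⟩ := hcol fun v => col (emb e v)
    refine ⟨Function.update ρ i c, fun τ => ?_⟩
    obtain ⟨q, hq, hq'⟩ := hρ τ
    refine ⟨(e, q), fun x => by rw [hpart, hq], fun x hx => ?_⟩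
    by_cases h : τ x = i
    · have h' : part (σ q x) = i := (hq x).trans h
      simp only [emb, h', h, dif_pos, Function.update_self]
      exact he _
    · rw [Function.update_of_ne h]
      exact hq' x (Finset.mem_of_mem_insert_of_ne hx h)
  · intro T hT f
    let F : E' → Finset E := fun e => (T.filter fun t => t.1 = e).image Prod.snd
    have hFmem : ∀ e q, (e, q) ∈ T → q ∈ F e := fun e q h =>
      Finset.mem_image.2 ⟨(e, q), Finset.mem_filter.2 ⟨h, rfl⟩, rfl⟩
    have hFle : ∀ e, (F e).card ≤ (T.filter fun t => t.1 = e).card := fun e =>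
      Finset.card_image_le
    have hFT : ∀ e, (F e).card < 2 * g := fun e =>
      ((hFle e).trans (Finset.card_filter_le _ _)).trans_lt hT
    choose ψ c hψ using fun e => hint (F e) (hFT e) fun q => f (e, q)
    -- Only copies containing at least two edges of `T` constrain the gluing; this halves the count
    -- and gives the doubling.
    let T₂ : Finset E' := (T.image Prod.fst).filter fun e => 2 ≤ (F e).card
    have hT₂ : T₂.card < g := by
      have h1 : T₂.card * 2 ≤ ∑ e ∈ T₂, (T.filter fun t => t.1 = e).card := by
        rw [← smul_eq_mul]
        exact Finset.card_nsmul_le_sum _ _ _ fun e he =>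
          (Finset.mem_filter.1 he).2.trans (hFle e)
      have h2 : ∑ e ∈ T₂, (T.filter fun t => t.1 = e).card ≤ T.card := by
        rw [Finset.card_eq_sum_card_image Prod.fst T]
        exact Finset.sum_le_sum_of_subset (Finset.filter_subset _ _)
      omega
    obtain ⟨φ, d, hφ⟩ := hint' T₂ hT₂ fun e x => ψ e x
    have hd : ∀ e, ∃ a, ∀ q, (e, q) ∈ T → ∀ x, ∀ h : part (σ q x) = i,
        φ (σ' e ⟨σ q x, h⟩) = ψ e (σ q x) + a := by
      intro e
      by_cases he : e ∈ T₂
      · exact ⟨d e, fun q _ x h => hφ e he _⟩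
      -- The single edge of `T` in this copy meets part `i` at most once, so a shift suffices.
      · by_cases hex : ∃ q x, (e, q) ∈ T ∧ part (σ q x) = i
        · obtain ⟨q, x, hq, hx⟩ := hex
          refine ⟨φ (σ' e ⟨σ q x, hx⟩) - ψ e (σ q x), fun q' hq' x' hx' => ?_⟩
          have hle : (F e).card ≤ 1 := by
            by_contra hlt
            exact he (Finset.mem_filter.2 ⟨Finset.mem_image.2 ⟨(e, q), hq, rfl⟩, by omega⟩)
          obtain rfl := Finset.card_le_one.1 hle _ (hFmem e q hq) _ (hFmem e q' hq')
          obtain rfl : x = x' := hinj q (hx.trans hx'.symm)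
          abel
        · exact ⟨0, fun q hq x hx => (hex ⟨q, x, hq, hx⟩).elim⟩
    choose d' hd' using hd
    refine ⟨Sum.elim φ fun v => ψ v.1 v.2 + d' v.1, fun e => c e.1 e.2 + d' e.1, ?_⟩
    rintro ⟨e, q⟩ hq x
    have key := hψ e q (hFmem e q hq) x
    by_cases h : part (σ q x) = i
    · simp only [emb, h, dif_pos, Sum.elim_inl]
      rw [hd' e q hq x h, key, add_assoc]
    · simp only [emb, h, dif_neg, not_false_eq_true, Sum.elim_inr]
      rw [key, add_assoc]

theorem exists_embedding_const {K : Type} [Finite K] (n : ℕ)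
    (ρ : Fin ((n + 1) * Nat.card K + 1) → Fin (n + 1)) :
    ∃ (τ : K ↪ Fin ((n + 1) * Nat.card K + 1)) (c : Fin (n + 1)), ∀ x, ρ (τ x) = c := by
  classical
  have := Fintype.ofFinite K
  obtain ⟨c, hc⟩ := Fintype.exists_lt_card_fiber_of_mul_lt_card (n := Nat.card K) ρ (by simp)
  obtain ⟨τ⟩ : Nonempty (K ↪ {i // ρ i = c}) := by
    refine Function.Embedding.nonempty_of_card_le ?_
    rw [Fintype.card_subtype, ← Nat.card_eq_fintype_card]
    exact hc.le
  exact ⟨τ.trans (Function.Embedding.subtype _), c, fun x => (τ x).2⟩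

/-- Once every part has been amalgamated, the colour on chosen edges depends only on the part. By
pigeonhole `Nat.card K` parts share a colour, and the edge over them is monochromatic. `K` varies in
the induction because amalgamation uses hypergraphs whose edges are as large as a whole part. -/
theorem hasSparseHypergraph_two_pow (Γ : Type) [AddCommGroup Γ] (n r : ℕ) (K : Type) [Finite K] :
    HasSparseHypergraph Γ K n (2 ^ r) := by
  induction r generalizing K with
  | zero =>
    -- Sparseness `1` only concerns `T = ∅`, so a degenerate edge is allowed.
    refine ⟨Unit, Unit, inferInstance, inferInstance, fun _ _ => (), fun col =>
      ⟨(), col (), fun _ => rfl⟩, fun T hT f => ⟨0, 0, ?_⟩⟩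
    have : T = ∅ := by simpa using hT
    simp [this]
  | succ r ih =>
    have hP : ∀ J, HasPartiteHypergraph Γ K (Fin ((n + 1) * Nat.card K + 1)) J n (2 * 2 ^ r) := by
      intro J
      induction J using Finset.induction_on with
      | empty => exact hasPartiteHypergraph_empty ..
      | insert i J _ hJ => exact hJ.insert i fun L _ => ih L
    obtain ⟨V, E, hV, hE, σ, part, -, hcol, hint⟩ := hP Finset.univ
    refine ⟨V, E, hV, hE, σ, fun col => ?_, by rwa [pow_succ']⟩
    obtain ⟨ρ, hρ⟩ := hcol col
    obtain ⟨τ, c, hτ⟩ := exists_embedding_const n ρ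
    obtain ⟨e, -, he⟩ := hρ τ
    exact ⟨e, c, fun x => (he x (Finset.mem_univ _)).trans (hτ x)⟩

/-! ### Tutte's construction for labelled transitive relations. -/

/-- A labelled transitive relation is `g`-integrable if fewer than `g` of its labels are always
the differences of a function on the vertices. -/
def IsIntegrable {W Γ : Type} [AddCommGroup Γ] (R : W → W → Γ → Prop) (g : ℕ) : Prop :=
  ∀ (ι : Type) [Fintype ι], Fintype.card ι < g → ∀ (u v : ι → W) (a : ι → Γ),
    (∀ i, R (u i) (v i) (a i)) → ∃ φ : W → Γ, ∀ i, φ (v i) - φ (u i) = a i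

/-- One step of Tutte's construction: a copy of `R` for each edge of a hypergraph, each vertex of
which is joined to the corresponding vertex of the edge. -/
inductive TutteRel {B E W Γ : Type} [AddCommGroup Γ] (σ : E → W → B) (R : W → W → Γ → Prop)
    (α : Γ) : B ⊕ E × W → B ⊕ E × W → Γ → Prop
  | copy (e : E) {u v : W} {a : Γ} : R u v a → TutteRel σ R α (Sum.inr (e, u)) (Sum.inr (e, v)) a
  | last (e : E) (u : W) : TutteRel σ R α (Sum.inr (e, u)) (Sum.inl (σ e u)) α
  | mixed (e : E) {u v : W} {a : Γ} :
      R u v a → TutteRel σ R α (Sum.inr (e, u)) (Sum.inl (σ e v)) (a + α)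

theorem TutteRel.trans {B E W Γ : Type} [AddCommGroup Γ] {σ : E → W → B} {R : W → W → Γ → Prop}
    {α : Γ} (hR : ∀ u v w a b, R u v a → R v w b → R u w (a + b)) {u v w : B ⊕ E × W} {a b : Γ}
    (h₁ : TutteRel σ R α u v a) (h₂ : TutteRel σ R α v w b) : TutteRel σ R α u w (a + b) := by
  cases h₁ with
  -- No arrow leaves a vertex of `B`.
  | last | mixed => cases h₂
  | copy e h =>
    cases h₂ with
    | copy _ h' => exact .copy e (hR _ _ _ _ _ h h')
    | last => exact .mixed e h
    | mixed _ h' => rw [← add_assoc]; exact .mixed e (hR _ _ _ _ _ h h')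

/-- Integrate inside each copy, then use sparseness to shift these potentials until they agree with
one function on `B`; raising that function by `α` accounts for the joining arrows. -/
theorem IsIntegrable.tutteRel {B E W Γ : Type} [AddCommGroup Γ] {σ : E → W → B}
    {R : W → W → Γ → Prop} {α : Γ} {g : ℕ} (hR : IsIntegrable R g)
    (hσ : ∀ T : Finset E, T.card < g → ∀ f : E → W → Γ, ∃ (φ : B → Γ) (c : E → Γ),
      ∀ e ∈ T, ∀ x, φ (σ e x) = f e x + c e) :
    IsIntegrable (TutteRel σ R α) g := by
  classical
  intro ι _ hι u v a h
  have key : ∀ i, ∃ (e : E) (u' v' : W) (a' : Γ), (R u' v' a' ∨ (u' = v' ∧ a' = 0)) ∧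
      ∀ (φ : B → Γ) (ψ : E → W → Γ), (∀ x, φ (σ e x) = ψ e x) → ψ e v' - ψ e u' = a' →
        Sum.elim (fun b => φ b + α) (fun w => ψ w.1 w.2) (v i) -
          Sum.elim (fun b => φ b + α) (fun w => ψ w.1 w.2) (u i) = a i := by
    intro i
    have hi := h i
    generalize u i = u₀, v i = v₀, a i = a₀ at hi ⊢
    cases hi with
    | copy e h => exact ⟨e, _, _, _, .inl h, fun φ ψ _ h => h⟩
    | last e u =>
      refine ⟨e, u, u, 0, .inr ⟨rfl, rfl⟩, fun φ ψ h _ => ?_⟩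
      simp [h]
    | mixed e h =>
      refine ⟨e, _, _, _, .inl h, fun φ ψ h h' => ?_⟩
      simp [h, ← h']
      abel
  choose e u' v' a' hR' hφ using key
  have hψ : ∀ e₀, ∃ ψ : W → Γ, ∀ i, e i = e₀ → ψ (v' i) - ψ (u' i) = a' i := by
    intro e₀
    obtain ⟨ψ, hψ⟩ := hR {i // R (u' i) (v' i) (a' i)}
      ((Fintype.card_subtype_le _).trans_lt hι) (fun i => u' i) (fun i => v' i) (fun i => a' i)
      fun i => i.2
    refine ⟨ψ, fun i _ => ?_⟩
    rcases hR' i with h | ⟨h, h'⟩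
    · exact hψ ⟨i, h⟩
    · rw [h, h', sub_self]
  choose ψ hψ using hψ
  obtain ⟨φ, c, hφ'⟩ := hσ (Finset.univ.image e) (Finset.card_image_le.trans_lt hι) ψ
  refine ⟨_, fun i => hφ i φ (fun e x => ψ e x + c e) (fun x => ?_) ?_⟩
  · exact hφ' _ (Finset.mem_image_of_mem _ (Finset.mem_univ _)) x
  · rw [add_sub_add_right_eq_sub, hψ _ i rfl]

/-- Take an edge monochromatic in colour `c`. Either its copy uses `c`, and a joining arrow is
monochromatic, or the copy has one colour fewer and induction applies. -/
theorem exists_integrable_relation {Γ : Type} [AddCommGroup Γ] (α : Γ) (g n : ℕ) :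
    ∃ (W : Type) (_ : Finite W) (R : W → W → Γ → Prop),
      (∀ u v w a b, R u v a → R v w b → R u w (a + b)) ∧ IsIntegrable R g ∧
      ∀ col : W → Fin n, ∃ u v, R u v α ∧ col u = col v := by
  induction n with
  | zero =>
    refine ⟨Unit, inferInstance, fun _ _ _ => False, by simp, fun ι _ _ u v a h => ?_,
      fun col => (col ()).elim0⟩
    exact ⟨0, fun i => (h i).elim⟩
  | succ n ih =>
    obtain ⟨W, _, R, htrans, hint, hcol⟩ := ih
    obtain ⟨B, E, _, _, σ, hσ, hσ'⟩ := hasSparseHypergraph_two_pow Γ n g W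
    refine ⟨B ⊕ E × W, inferInstance, TutteRel σ R α, fun _ _ _ _ _ => TutteRel.trans htrans,
      hint.tutteRel fun T hT => hσ' T (hT.trans Nat.lt_two_pow_self), fun col => ?_⟩
    obtain ⟨e, c, he⟩ := hσ fun b => col (Sum.inl b)
    by_cases h : ∃ v, col (Sum.inr (e, v)) = c
    · obtain ⟨v, hv⟩ := h
      exact ⟨_, _, .last e v, hv.trans (he v).symm⟩
    · push Not at h
      choose col' hcol' using fun v => Fin.exists_succAbove_eq (h v)
      obtain ⟨u, v, huv, h'⟩ := hcol col'
      exact ⟨_, _, .copy e huv, by rw [← hcol', ← hcol', h']⟩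

/-! ### Odd cycles and bipartiteness. -/

/-- Each closed piece cut out by `bypass` is a cycle or a step back and forth, hence even. -/
theorem SimpleGraph.Walk.even_length_add_length_bypass {V : Type*} [DecidableEq V]
    {G : SimpleGraph V} (hG : ∀ a (w : G.Walk a a), w.IsCycle → Even w.length) {u v : V}
    (w : G.Walk u v) : Even (w.length + w.bypass.length) := by
  induction w with
  | nil => simp [bypass]
  | cons h p ih =>
    simp only [bypass]
    split_ifs with hs
    · have hlen := congrArg Walk.length (p.bypass.take_spec hs)
      rw [length_append] at hlen
      have heven : Even (cons h (p.bypass.takeUntil _ hs)).length := by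
        by_contra hodd
        have hpos : (p.bypass.takeUntil _ hs).length ≠ 0 := fun h0 =>
          h.ne (eq_of_length_eq_zero h0).symm
        refine hodd (hG _ _ (isCycle_iff_isPath_tail_and_le_length.2 ⟨?_, ?_⟩))
        · simpa using p.bypass_isPath.takeUntil hs
        · rw [Nat.not_even_iff_odd] at hodd
          obtain ⟨m, hm⟩ := hodd
          rw [length_cons] at hm ⊢
          omega
      rw [length_cons] at heven ⊢
      grind
    · rw [length_cons, length_cons]
      grind

theorem SimpleGraph.isBipartite_of_forall_isCycle_even {V : Type*} {G : SimpleGraph V}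
    (hG : ∀ a (w : G.Walk a a), w.IsCycle → Even w.length) : G.IsBipartite := by
  classical
  refine two_colorable_iff_forall_loop_even.2 fun u w => ?_
  have h := w.even_length_add_length_bypass hG
  rwa [(Walk.isPath_iff_nil.1 w.bypass_isPath).length_eq_zero, add_zero] at h

theorem SimpleGraph.oddGirth_le {V : Type*} {G : SimpleGraph V} {a : V} {w : G.Walk a a}
    (hw : w.IsCycle) (hodd : Odd w.length) : G.oddGirth ≤ w.length :=
  iInf_le_of_le a <| iInf_le_of_le w <| iInf_le_of_le ⟨hw, hodd⟩ le_rfl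

theorem SimpleGraph.oddGirth_ne_top {V : Type*} {G : SimpleGraph V} (hG : ¬ G.IsBipartite) :
    G.oddGirth ≠ ⊤ := by
  intro h
  refine hG (isBipartite_of_forall_isCycle_even fun a w hw => ?_)
  by_contra hodd
  have := oddGirth_le hw (Nat.not_even_iff_odd.1 hodd)
  rw [h, top_le_iff] at this
  exact ENat.natCast_ne_top _ this

theorem SimpleGraph.Embedding.oddGirth_le {V W : Type*} {F : SimpleGraph V} {G : SimpleGraph W}
    (f : F ↪g G) : G.oddGirth ≤ F.oddGirth := by
  refine le_iInf fun a => le_iInf fun w => le_iInf fun hw => ?_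
  have h := SimpleGraph.oddGirth_le (w := w.map f.toHom) (hw.1.map f.injective)
    (by rw [Walk.length_map]; exact hw.2)
  rwa [Walk.length_map] at h

/-! ### Generic residues modulo a prime. -/

theorem eq_zero_of_sum_mul_pow_eq_zero (B : ℤ) {k : ℕ} (c : Fin k → ℤ) (hc : ∀ i, |c i| < B)
    (h : ∑ i, c i * B ^ (i : ℕ) = 0) : c = 0 := by
  induction k with
  | zero => exact Subsingleton.elim _ _
  | succ k ih =>
    rw [Fin.sum_univ_succ] at h
    have hsum : ∑ i : Fin k, c i.succ * B ^ (i.succ : ℕ)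
        = B * ∑ i : Fin k, c i.succ * B ^ (i : ℕ) := by
      rw [Finset.mul_sum]
      refine Finset.sum_congr rfl fun i _ => ?_
      rw [Fin.val_succ, pow_succ]
      ring
    rw [hsum] at h
    simp only [Fin.val_zero, pow_zero, mul_one] at h
    have hB : 0 < B := (abs_nonneg _).trans_lt (hc 0)
    have h0 : c 0 = 0 := by
      refine Int.eq_zero_of_abs_lt_dvd (m := B) ?_ (hc 0)
      exact ⟨-∑ i : Fin k, c i.succ * B ^ (i : ℕ), by linarith⟩
    rw [h0, zero_add, mul_eq_zero] at h
    have hs := ih (fun i => c i.succ) (fun i => hc _) (h.resolve_left hB.ne')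
    funext i
    refine Fin.cases h0 (fun i => congrFun hs i) i

/-- Numbers without nontrivial relations of height at most `N`. -/
def IsGeneric {V : Type*} [Fintype V] {p : ℕ} (x : V → ZMod p) (N : ℕ) : Prop :=
  ∀ c : V → ℤ, (∀ v, |c v| ≤ N) → ∑ v, (c v : ZMod p) * x v = 0 → c = 0

/-- Modulo a suitable prime there are numbers without nontrivial relations of bounded height. -/
theorem exists_prime_generic (V : Type*) [Fintype V] (N : ℕ) :
    ∃ p : ℕ, p.Prime ∧ ∃ x : V → ZMod p, IsGeneric x N := by
  let e := Fintype.equivFin V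
  let B : ℤ := N + 1
  -- The residues are powers of `N + 1`; `p` exceeds every combination of height at most `N`, so
  -- vanishing modulo `p` means vanishing in `ℤ`.
  obtain ⟨p, hp, hprime⟩ :=
    Nat.exists_infinite_primes ((∑ v, (N : ℤ) * B ^ (e v : ℕ)).toNat + 1)
  refine ⟨p, hprime, fun v => ((B ^ (e v : ℕ) : ℤ) : ZMod p), fun c hc h => ?_⟩
  have hcast : ((∑ v, c v * B ^ (e v : ℕ) : ℤ) : ZMod p) = 0 := by
    rw [← h]
    push_cast
    rfl
  have hlt : |∑ v, c v * B ^ (e v : ℕ)| < p := by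
    calc |∑ v, c v * B ^ (e v : ℕ)| ≤ ∑ v, |c v * B ^ (e v : ℕ)| := Finset.abs_sum_le_sum_abs _ _
      _ ≤ ∑ v, (N : ℤ) * B ^ (e v : ℕ) := by
        refine Finset.sum_le_sum fun v _ => ?_
        have hB : (0 : ℤ) ≤ B ^ (e v : ℕ) := by positivity
        rw [abs_mul, abs_of_nonneg hB]
        exact mul_le_mul_of_nonneg_right (hc v) hB
      _ < p := by omega
  have hzero : ∑ v, c v * B ^ (e v : ℕ) = 0 :=
    Int.eq_zero_of_abs_lt_dvd ((ZMod.intCast_zmod_eq_zero_iff_dvd _ _).1 hcast) hlt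
  have hfin : ∑ i, c (e.symm i) * B ^ (i : ℕ) = 0 := by
    rw [← hzero, ← e.sum_comp]
    simp
  have := eq_zero_of_sum_mul_pow_eq_zero B (fun i => c (e.symm i))
    (fun i => (hc _).trans_lt (by simp [B])) hfin
  funext v
  simpa using congrFun this (e v)

/-- A nonzero label determines its ordered pair: the difference of the two sides is a relation of
height at most `2`. -/
theorem IsGeneric.eq_of_sub_eq_sub {V : Type*} [Fintype V] {p : ℕ} {x : V → ZMod p}
    (hx : IsGeneric x 2) {a b v w : V} (hab : a ≠ b) (h : x b - x a = x w - x v) :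
    a = v ∧ b = w := by
  classical
  have h0 := hx (Pi.single b 1 - Pi.single a 1 - Pi.single w 1 + Pi.single v 1) (fun u => by
    simp only [Pi.add_apply, Pi.sub_apply, Pi.single_apply]
    split_ifs <;> simp_all) (by
    simp only [Pi.add_apply, Pi.sub_apply, Pi.single_apply, Int.cast_add, Int.cast_sub,
      Int.cast_ite, Int.cast_one, Int.cast_zero, add_mul, sub_mul, ite_mul, one_mul, zero_mul,
      Finset.sum_add_distrib, Finset.sum_sub_distrib, Finset.sum_ite_eq',
      Finset.mem_univ, if_true]
    rw [h]
    ring)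
  have ha := congrFun h0 a
  have hb := congrFun h0 b
  simp only [Pi.add_apply, Pi.sub_apply, Pi.single_apply, Pi.zero_apply] at ha hb
  constructor
  · by_contra hne
    simp only [hab, hne, if_true, if_false] at ha
    split_ifs at ha <;> omega
  · by_contra hne
    simp only [hab.symm, hne, if_true, if_false] at hb
    split_ifs at hb <;> omega

theorem IsGeneric.injective {V : Type*} [Fintype V] {p : ℕ} {x : V → ZMod p}
    (hx : IsGeneric x 2) : Function.Injective x := by
  intro a b h
  by_contra hne
  exact hne (hx.eq_of_sub_eq_sub hne (v := b) (w := b) (by rw [h])).1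

theorem IsGeneric.mono {V : Type*} [Fintype V] {p : ℕ} {x : V → ZMod p} {M N : ℕ}
    (hx : IsGeneric x N) (h : M ≤ N) : IsGeneric x M :=
  fun c hc => hx c fun v => (hc v).trans (by exact_mod_cast h)

/-- A list of darts of odd length, shorter than the odd girth, is never balanced. -/
theorem SimpleGraph.sum_darts_ne_zero {V : Type*} [Fintype V] {F : SimpleGraph V} {p N : ℕ}
    {x : V → ZMod p} (hx : IsGeneric x N) (L : List F.Dart) (hN : L.length ≤ N)
    (hodd : Odd L.length) (hL : (L.length : ℕ∞) < F.oddGirth) :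
    (L.map fun d => x d.snd - x d.fst).sum ≠ 0 := by
  classical
  intro h
  -- The net flow into `v`, which genericity forces to vanish.
  let c : V → ℤ := fun v =>
    (L.map fun d => (Pi.single d.snd 1 - Pi.single d.fst 1 : V → ℤ) v).sum
  have hsum : ∀ {R : Type} [CommRing R] (f : V → R),
      (L.map fun d => f d.snd - f d.fst).sum = ∑ v, (c v : R) * f v := by
    intro R _ f
    simp only [c]
    clear * -
    induction L with
    | nil => simp
    | cons d L ih =>
      simp only [List.map_cons, List.sum_cons, Int.cast_add, add_mul, Finset.sum_add_distrib]
      rw [ih]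
      simp [Pi.single_apply, sub_mul, ite_mul]
  have hc : c = 0 := by
    refine hx c (fun v => ?_) (by rw [← hsum, h])
    refine le_trans ?_ (Int.ofNat_le.2 hN)
    simp only [c]
    clear * -
    induction L with
    | nil => simp
    | cons d L ih =>
      simp only [List.map_cons, List.sum_cons, List.length_cons]
      refine (abs_add_le _ _).trans ?_
      have : |(Pi.single d.snd 1 - Pi.single d.fst 1 : V → ℤ) v| ≤ 1 := by
        simp only [Pi.sub_apply, Pi.single_apply]
        split_ifs <;> simp
      push_cast at ih ⊢
      linarith
  -- The edges used are too few for an odd cycle of `F`, so they have a 2-colouring; paired with the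
  -- zero flow modulo `2`, each dart contributes `1`, making the length even.
  let F' : SimpleGraph V := fromEdgeSet {e | e ∈ L.map Dart.edge}
  have hF' : F' ≤ F := by
    intro a b hab
    obtain ⟨hab, -⟩ := (fromEdgeSet_adj _).1 hab
    obtain ⟨d, -, hd⟩ := List.mem_map.1 hab
    exact F.mem_edgeSet.1 (hd ▸ d.edge_mem)
  obtain ⟨col⟩ : F'.Colorable 2 := by
    refine isBipartite_of_forall_isCycle_even fun a w hw => ?_
    by_contra hw'
    have h1 := oddGirth_le (hw.mapLe hF') (by
      rw [Walk.length_map]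
      exact Nat.not_even_iff_odd.1 hw')
    rw [Walk.length_map] at h1
    have h2 : w.length ≤ L.length := by
      rw [← w.length_edges, ← L.length_map Dart.edge]
      refine (hw.edges_nodup.subperm fun e he => ?_).length_le
      have := w.edges_subset_edgeSet he
      rw [edgeSet_fromEdgeSet] at this
      exact this.1
    exact absurd (hL.trans_le h1) (by simpa using h2)
  have h1 := hsum (R := ZMod 2) fun v => ((col v : ℕ) : ZMod 2)
  rw [hc] at h1
  simp only [Pi.zero_apply, Int.cast_zero, zero_mul, Finset.sum_const_zero] at h1
  have h2 : ∀ d ∈ L, ((col d.snd : ℕ) : ZMod 2) - ((col d.fst : ℕ) : ZMod 2) = 1 := by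
    intro d hd
    have hne : col d.fst ≠ col d.snd := col.valid
      ((fromEdgeSet_adj _).2 ⟨List.mem_map.2 ⟨d, hd, rfl⟩, d.adj.ne⟩)
    generalize col d.fst = i, col d.snd = j at hne ⊢
    revert i j
    decide
  rw [List.map_congr_left h2, List.map_const', List.sum_replicate, nsmul_eq_mul, mul_one,
    ZMod.natCast_eq_zero_iff_even] at h1
  exact Nat.not_even_iff_odd.2 hodd h1

/-! ### Odd girth and chromatic number of the label graph. -/

/-- The graph whose edges are the pairs with a label `x b - x a` for adjacent `a`, `b`. -/
def labelGraph {V : Type*} {W : Type} {p : ℕ} (F : SimpleGraph V) (x : V → ZMod p)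
    (R : W → W → ZMod p → Prop) : SimpleGraph W :=
  SimpleGraph.fromRel fun u v => ∃ a b, F.Adj a b ∧ R u v (x b - x a)

theorem le_oddGirth_labelGraph {V : Type*} [Fintype V] {W : Type} {p g : ℕ} {F : SimpleGraph V}
    {x : V → ZMod p} {R : W → W → ZMod p → Prop} (hR : IsIntegrable R g) (hx : IsGeneric x g)
    (hg : F.oddGirth ≤ g) : F.oddGirth ≤ (labelGraph F x R).oddGirth := by
  refine le_iInf fun a => le_iInf fun w => le_iInf fun hw => ?_
  by_contra! hlt
  have hlen : w.length < g := by exact_mod_cast hlt.trans_le hg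
  have hd : ∀ i : Fin w.darts.length, ∃ (u v : W) (a b : V), F.Adj a b ∧ R u v (x b - x a) ∧
      ((u = w.darts[i].fst ∧ v = w.darts[i].snd) ∨ (u = w.darts[i].snd ∧ v = w.darts[i].fst)) := by
    intro i
    obtain ⟨-, ⟨a, b, hab, h⟩ | ⟨a, b, hab, h⟩⟩ :=
      (SimpleGraph.fromRel_adj _ _ _).1 w.darts[i].adj
    · exact ⟨_, _, a, b, hab, h, .inl ⟨rfl, rfl⟩⟩
    · exact ⟨_, _, a, b, hab, h, .inr ⟨rfl, rfl⟩⟩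
  choose u v a b hab hRuv huv using hd
  obtain ⟨φ, hφ⟩ := hR (Fin w.darts.length) (by simpa using hlen) u v _ hRuv
  have key : ∀ d ∈ w.darts, ∃ d' : F.Dart, φ d.snd - φ d.fst = x d'.snd - x d'.fst := by
    intro d hd
    obtain ⟨i, hi, rfl⟩ := List.mem_iff_getElem.1 hd
    have h := hφ ⟨i, hi⟩
    rcases huv ⟨i, hi⟩ with ⟨h1, h2⟩ | ⟨h1, h2⟩ <;> rw [h1, h2] at h
    · exact ⟨⟨(_, _), hab ⟨i, hi⟩⟩, h⟩
    · refine ⟨⟨(_, _), (hab ⟨i, hi⟩).symm⟩, ?_⟩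
      rw [← neg_sub, ← neg_sub (x _)]
      exact congrArg Neg.neg h
  have hlist : ∀ {s t : W} (q : (labelGraph F x R).Walk s t),
      (∀ d ∈ q.darts, ∃ d' : F.Dart, φ d.snd - φ d.fst = x d'.snd - x d'.fst) →
      ∃ L : List F.Dart, L.length = q.length ∧
        (L.map fun d => x d.snd - x d.fst).sum = φ t - φ s := by
    intro s t q
    induction q with
    | nil => exact fun _ => ⟨[], by simp⟩
    | cons h q ih =>
      intro hq
      obtain ⟨L, hL, hL'⟩ := ih fun d hd => hq d (by simp [hd])
      obtain ⟨d', hd'⟩ := hq ⟨(_, _), h⟩ (by simp)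
      refine ⟨d' :: L, by simp [hL], ?_⟩
      rw [List.map_cons, List.sum_cons, hL', ← hd']
      abel
  obtain ⟨L, hL, hL'⟩ := hlist w key
  rw [sub_self] at hL'
  refine SimpleGraph.sum_darts_ne_zero hx L ?_ ?_ ?_ hL' <;> rw [hL]
  exacts [hlen.le, hw.2, hlt]

/-- Integrability of a single label excludes loops with nonzero label, so the monochromatic arrow is
an edge. -/
theorem not_colorable_labelGraph {V : Type*} {W : Type} {p n : ℕ} {F : SimpleGraph V}
    {x : V → ZMod p} {R : W → W → ZMod p → Prop} (hR : IsIntegrable R 2) {a b : V}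
    (hab : F.Adj a b) (hne : x a ≠ x b)
    (hcol : ∀ col : W → Fin n, ∃ u v, R u v (x b - x a) ∧ col u = col v) :
    ¬ (labelGraph F x R).Colorable n := by
  rintro ⟨col⟩
  obtain ⟨u, v, huv, h⟩ := hcol col
  refine col.valid ((SimpleGraph.fromRel_adj _ _ _).2 ⟨?_, .inl ⟨a, b, hab, huv⟩⟩) h
  rintro rfl
  obtain ⟨φ, hφ⟩ := hR Unit (by simp) (fun _ => u) (fun _ => u) _ fun _ => huv
  have := hφ ()
  rw [sub_self] at this
  exact hne (sub_eq_zero.1 this.symm).symm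

/-! ### Colouring `F`-free induced subgraphs. -/

theorem exists_chain_of_iterate {W : Type*} (r : W → W → Prop) (C : ℕ → W → Prop)
    (hC : ∀ m v, C (m + 1) v → ∃ u, C m u ∧ r u v) (m : ℕ) (v : W) (h : C m v) :
    ∃ f : ℕ → W, f m = v ∧ ∀ i < m, r (f i) (f (i + 1)) := by
  induction m generalizing v with
  | zero => exact ⟨fun _ => v, rfl, by simp⟩
  | succ m ih =>
    obtain ⟨u, hu, huv⟩ := hC m v h
    obtain ⟨f, hf, hf'⟩ := ih u hu
    refine ⟨fun i => if i ≤ m then f i else v, by simp, fun i hi => ?_⟩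
    rcases Nat.lt_succ_iff_lt_or_eq.1 hi with hi' | rfl
    · simpa [hi'.le, Nat.succ_le_of_lt hi'] using hf' i hi'
    · simpa [hf] using huv

/-- A relation without long chains is coloured by heights. -/
theorem exists_coloring_or_exists_chain {W : Type*} (r : W → W → Prop) (N : ℕ) :
    (∃ col : W → Fin (N + 1), ∀ u v, r u v → col u ≠ col v) ∨
      ∃ f : ℕ → W, ∀ i < N, r (f i) (f (i + 1)) := by
  classical
  let C : ℕ → W → Prop := fun m =>
    Nat.rec (motive := fun _ => W → Prop) (fun _ => True) (fun _ ih v => ∃ u, ih u ∧ r u v) m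
  by_cases h : ∃ v, C N v
  · obtain ⟨v, hv⟩ := h
    obtain ⟨f, -, hf⟩ := exists_chain_of_iterate r C (fun m v h => h) N v hv
    exact .inr ⟨f, hf⟩
  · refine .inl ⟨fun v => ⟨Nat.findGreatest (C · v) N, Nat.lt_succ_of_le (Nat.findGreatest_le _)⟩,
      fun u v huv he => ?_⟩
    have he := congrArg Fin.val he
    dsimp only at he
    have hu : C (Nat.findGreatest (C · u) N) u :=
      Nat.findGreatest_spec (P := (C · u)) (Nat.zero_le N) trivial
    have hle : Nat.findGreatest (C · u) N ≤ N := Nat.findGreatest_le _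
    have hlt : Nat.findGreatest (C · u) N < N := by
      refine lt_of_le_of_ne hle fun hN => h ⟨u, ?_⟩
      rwa [hN] at hu
    have := Nat.le_findGreatest (P := (C · v)) (Nat.succ_le_of_lt hlt) ⟨u, hu, huv⟩
    omega

/-- Along the chain the label from `f i` to a later `f j` is `(j - i) * t`. Suitable positions
realise every `x w - x v`, and genericity makes such a label an edge label exactly when `v` and `w`
are adjacent. -/
theorem isIndContained_of_chain {V : Type*} [Fintype V] {W : Type} {p : ℕ} [Fact p.Prime]
    {F : SimpleGraph V} {x : V → ZMod p} {R : W → W → ZMod p → Prop}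
    (htrans : ∀ u v w a b, R u v a → R v w b → R u w (a + b)) (hR : IsIntegrable R 3)
    (hx : IsGeneric x 2) {s : Set W} {t : ZMod p} (ht : t ≠ 0) (f : ℕ → s)
    (hf : ∀ i < p * Fintype.card V, R (f i) (f (i + 1)) t) :
    F.IsIndContained ((labelGraph F x R).induce s) := by
  have hchain : ∀ i m, i + (m + 1) ≤ p * Fintype.card V →
      R (f i) (f (i + (m + 1))) (((m + 1 : ℕ) : ZMod p) * t) := by
    intro i m
    induction m with
    | zero =>
      intro h
      simpa using hf i (by omega)
    | succ m ih =>
      intro h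
      have h2 := htrans _ _ _ _ _ (ih (by omega)) (hf (i + (m + 1)) (by omega))
      rw [Nat.cast_succ (m + 1), add_mul, one_mul]
      exact h2
  let e := Fintype.equivFin V
  -- Each vertex has its own block of `p` positions, and within it the one whose multiple of `t` is
  -- `x v`.
  let pos : V → ℕ := fun v => p * (e v : ℕ) + (x v / t).val
  have hval : ∀ v, (x v / t).val < p := fun v => ZMod.val_lt _
  have hposle : ∀ v, pos v ≤ p * Fintype.card V := by
    intro v
    have h1 : p * ((e v : ℕ) + 1) ≤ p * Fintype.card V := Nat.mul_le_mul_left _ (e v).2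
    have := hval v
    simp only [pos]
    rw [mul_add, mul_one] at h1
    omega
  have hpos : ∀ v, ((pos v : ℕ) : ZMod p) * t = x v := by
    intro v
    simp [pos, ht]
  have hlabel : ∀ v w, e v < e w → R (f (pos v)) (f (pos w)) (x w - x v) := by
    intro v w h
    have h1 : p * ((e v : ℕ) + 1) ≤ p * (e w : ℕ) := Nat.mul_le_mul_left _ h
    have hlt : pos v < pos w := by
      have := hval v
      simp only [pos]
      rw [mul_add, mul_one] at h1
      omega
    obtain ⟨m, hm⟩ := Nat.exists_eq_add_of_lt hlt
    have h2 := hchain (pos v) m (by rw [← add_assoc, ← hm]; exact hposle w)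
    rw [← add_assoc, ← hm] at h2
    convert h2 using 1
    rw [← hpos v, ← hpos w, hm]
    push_cast
    ring
  -- Integrating two labels at once, hence the bound `3`, makes labels unique up to reversal.
  have huniq : ∀ {u v : W} {a b : ZMod p}, R u v a → (R u v b → a = b) ∧ (R v u b → a = -b) := by
    intro u v a b h
    constructor <;> intro h'
    · obtain ⟨φ, hφ⟩ := hR Bool (by simp) (fun _ => u) (fun _ => v)
        (fun i => if i then a else b) (by simp [h, h'])
      have h1 := hφ true
      have h2 := hφ false
      simp only [if_true, Bool.false_eq_true, if_false] at h1 h2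
      rw [← h1, ← h2]
    · obtain ⟨φ, hφ⟩ := hR Bool (by simp) (fun i => if i then u else v)
        (fun i => if i then v else u) (fun i => if i then a else b) (by simp [h, h'])
      have h1 := hφ true
      have h2 := hφ false
      simp only [if_true, Bool.false_eq_true, if_false] at h1 h2
      rw [← h1, ← h2, neg_sub]
  have hadj : ∀ v w, e v < e w →
      ((labelGraph F x R).Adj (f (pos v)) (f (pos w)) ↔ F.Adj v w) := by
    intro v w h
    have hne : v ≠ w := by
      rintro rfl
      exact lt_irrefl _ h
    have hl := hlabel v w h
    unfold labelGraph
    rw [SimpleGraph.fromRel_adj]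
    constructor
    · rintro ⟨-, ⟨a, b, hab, hr⟩ | ⟨a, b, hab, hr⟩⟩
      · obtain ⟨rfl, rfl⟩ := hx.eq_of_sub_eq_sub hne ((huniq hl).1 hr)
        exact hab
      · have := (huniq hl).2 hr
        rw [neg_sub] at this
        obtain ⟨rfl, rfl⟩ := hx.eq_of_sub_eq_sub hne this
        exact hab.symm
    · intro hvw
      refine ⟨fun heq => ?_, .inl ⟨v, w, hvw, hl⟩⟩
      rw [heq] at hl
      have := (huniq hl).2 hl
      rw [neg_sub] at this
      exact hne (hx.eq_of_sub_eq_sub hne this).1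
  have hadj' : ∀ v w, ((labelGraph F x R).Adj (f (pos v)) (f (pos w)) ↔ F.Adj v w) := by
    intro v w
    rcases lt_trichotomy (e v) (e w) with h | h | h
    · exact hadj v w h
    · rw [e.injective h]
      simp
    · rw [SimpleGraph.adj_comm, hadj w v h, F.adj_comm]
  have hinj : ∀ v w, e v < e w → f (pos v) ≠ f (pos w) := by
    intro v w h heq
    have hl := hlabel v w h
    rw [heq] at hl
    have := (huniq hl).2 hl
    rw [neg_sub] at this
    have hne : v ≠ w := by
      rintro rfl
      exact lt_irrefl _ h
    exact hne (hx.eq_of_sub_eq_sub hne this).1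
  refine ⟨⟨⟨fun v => f (pos v), fun v w h => ?_⟩, fun {v w} => hadj' v w⟩⟩
  rcases lt_trichotomy (e v) (e w) with h' | h' | h'
  · exact (hinj v w h' h).elim
  · exact e.injective h'
  · exact (hinj w v h' h.symm).elim

theorem colorable_induce_labelGraph {V : Type*} [Fintype V] {W : Type} {p : ℕ} [Fact p.Prime]
    {F : SimpleGraph V} {x : V → ZMod p} {R : W → W → ZMod p → Prop}
    (htrans : ∀ u v w a b, R u v a → R v w b → R u w (a + b)) (hR : IsIntegrable R 3)
    (hx : IsGeneric x 2) {s : Set W} (hs : ¬ F.IsIndContained ((labelGraph F x R).induce s)) :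
    ((labelGraph F x R).induce s).Colorable ((p * Fintype.card V + 1) ^ p) := by
  have hcol : ∀ t : ZMod p, ∃ col : s → Fin (p * Fintype.card V + 1),
      t ≠ 0 → ∀ u v : s, R u v t → col u ≠ col v := by
    intro t
    rcases exists_coloring_or_exists_chain (fun u v : s => R u v t) (p * Fintype.card V) with
      ⟨col, h⟩ | ⟨f, hf⟩
    · exact ⟨col, fun _ => h⟩
    · exact ⟨fun _ => 0, fun ht => (hs (isIndContained_of_chain htrans hR hx ht f hf)).elim⟩
  choose col hcol using hcol
  have hne : ∀ {a b}, F.Adj a b → x b - x a ≠ 0 := fun hab h =>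
    hab.ne' (hx.injective (sub_eq_zero.1 h))
  let C : ((labelGraph F x R).induce s).Coloring (ZMod p → Fin (p * Fintype.card V + 1)) :=
    SimpleGraph.Coloring.mk (fun v t => col t v) (by
      intro u v huv heq
      rw [SimpleGraph.induce_adj] at huv
      obtain ⟨-, ⟨a, b, hab, hr⟩ | ⟨a, b, hab, hr⟩⟩ := (SimpleGraph.fromRel_adj _ _ _).1 huv
      · exact hcol _ (hne hab) u v hr (congrFun heq _)
      · exact hcol _ (hne hab) v u hr (congrFun heq _).symm)
  simpa [ZMod.card] using C.colorable

theorem theorem1p4 {V : Type*} [Finite V] (F : SimpleGraph V) (hF : ¬ F.IsBipartite) :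
    ∃ c : ℕ, ∀ n : ℕ, ∃ (W : Type) (_ : Finite W) (G : SimpleGraph W),
      (n : ℕ∞) ≤ G.chromaticNumber ∧ G.oddGirth = F.oddGirth ∧
        ∀ s : Set W, ¬ F.IsIndContained (G.induce s) → (G.induce s).Colorable c := by
  have := Fintype.ofFinite V
  obtain ⟨g, hg⟩ := ENat.ne_top_iff_exists.1 (SimpleGraph.oddGirth_ne_top hF)
  obtain ⟨p, hp, x, hx⟩ := exists_prime_generic V (g + 3)
  have hx₂ : IsGeneric x 2 := hx.mono (by omega)
  have : Fact p.Prime := ⟨hp⟩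
  obtain ⟨a, b, hab⟩ : ∃ a b, F.Adj a b := by
    by_contra! h
    exact hF ⟨SimpleGraph.Coloring.mk (fun _ => 0) fun {a b} hab => (h a b hab).elim⟩
  refine ⟨(p * Fintype.card V + 1) ^ p, fun n => ?_⟩
  -- Failing `m` colours gives both the chromatic bound and, since `F`-free induced subgraphs need
  -- at most the second summand, an induced `F` in the whole graph.
  let m := n + (p * Fintype.card V + 1) ^ p
  obtain ⟨W, hW, R, htrans, hR, hcol⟩ := exists_integrable_relation (x b - x a) (g + 3) m
  have hR' : ∀ k ≤ g + 3, IsIntegrable R k := fun k hk ι _ hι => hR ι (hι.trans_le hk)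
  have hm : ¬ (labelGraph F x R).Colorable m :=
    not_colorable_labelGraph (hR' 2 (by omega)) hab (fun h => hab.ne (hx₂.injective h)) hcol
  have hs : ∀ s : Set W, ¬ F.IsIndContained ((labelGraph F x R).induce s) →
      ((labelGraph F x R).induce s).Colorable ((p * Fintype.card V + 1) ^ p) :=
    fun s => colorable_induce_labelGraph htrans (hR' 3 (by omega)) hx₂
  refine ⟨W, hW, labelGraph F x R, ?_, le_antisymm ?_ ?_, hs⟩
  · refine SimpleGraph.le_chromaticNumber_iff_colorable.2 fun k hk => ?_
    by_contra! hlt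
    have hkn : k < n := by exact_mod_cast hlt
    exact hm (hk.mono (by omega))
  · by_contra hlt
    refine hm (.mono (by omega) ((hs Set.univ fun ⟨f⟩ => hlt ?_).of_hom
      (SimpleGraph.induceUnivIso _).symm.toHom))
    exact ((SimpleGraph.induceUnivIso _).toEmbedding.comp f).oddGirth_le
  · exact le_oddGirth_labelGraph hR hx (by rw [← hg]; exact_mod_cast Nat.le_add_right g 3)
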